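/- Let $X$ be a real or complex Banach space. A $C_0$-semigroup on $X$ is a map $T:[0,\infty)\to\mathcal L(X)$ into the bounded linear operators with $T(0)=I$ and $T(l+m)=T(l)T(m)$ for all $l,m\ge 0$, which is continuous for the strong operator topology and satisfies $\|T(s)\|\le Me^{as}$ ($s\ge0$) for some $M\ge1$, $a\in\mathbb R$. Its generator is the linear operator $A$ given by $Ax=\lim_{h\downarrow0}h^{-1}(T(h)x-x)$, whose domain $\mathcal D(A)$ is the set of all $x\in X$ for which this limit exists; one writes $T(s)=\exp(sA)$. Let $t>0$, and let $C$ and $D$ be generators of $C_0$-semigroups $\exp(sC)$ and $\exp(sD)$ on $X$. The operator $C+D$ has domain $\mathcal D(C)\cap\mathcal D(D)$. Assume that (i) $\mathcal D(C)\cap\mathcal D(D)$ is dense in $X$; (ii) there exist $a\in\mathbb R$ and $M\ge1$ such that $$\Big\|\big\{\exp(\tfrac snC)\exp(\tfrac snD)\big\}^m\Big\|\le M\exp\big(as\tfrac mn\big)\qquad\text{for all } n,m\in\mathbb N,\ n\ge 1,\ s\ge0.$$ Then $C+D$ is closable and its closure $\overline{C+D}$ is the generator of a $C_0$-semigroup if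 and only if the following condition holds: $(*)$ there exists a dense linear subspace $A\subseteq\mathcal D(C)\cap\mathcal D(D)$ such that for all $f\in A$ and $s\ge0$ there exists a sequence $(f_n^s)_{n\ge1}$ in $\mathcal D(C)\cap\mathcal D(D)$ with (a) $\displaystyle\lim_{n\to\infty}\Big\|\big(\exp(\tfrac tnC)\exp(\tfrac tnD)\big)^{[ns]}f-f_n^s\Big\|=0$, where $[ns]$ is the integer part of $ns$; (b) the sets $\{f_n^s:n\ge1\}$ and $\{(C+D)f_n^s:n\ge1\}$ are precompact (have compact closure) in $X$. Furthermore, if $(*)$ holds, then $$\exp\big(s\,\overline{C+D}\big)f=\lim_{n\to\infty}\big\{\exp(\tfrac snC)\exp(\tfrac snD)\big\}^nf\qquad\text{for all } s>0,\ f\in X.$$ -/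

import Mathlib

open Filter Topology
open scoped NNReal

noncomputable section

variable {𝕜 X : Type*} [RCLike 𝕜] [NormedAddCommGroup X] [NormedSpace 𝕜 X]

/-- `y` is the strong derivative at `0` of `S : [0, ∞) → L(X)` in the direction `x`, that is,
`h⁻¹ (S(h) x - S(0) x) → y` as `h → 0`, `h > 0`. -/
def HasStrongDerivAtZero (S : ℝ≥0 → X →L[𝕜] X) (x y : X) : Prop :=
  Tendsto (fun h : ℝ≥0 => (((h : ℝ) : 𝕜))⁻¹ • (S h x - S 0 x)) (𝓝[>] 0) (𝓝 y)

theorem HasStrongDerivAtZero.unique {S : ℝ≥0 → X →L[𝕜] X} {x y z : X}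
    (hy : HasStrongDerivAtZero S x y) (hz : HasStrongDerivAtZero S x z) : y = z :=
  tendsto_nhds_unique hy hz

theorem HasStrongDerivAtZero.add {S : ℝ≥0 → X →L[𝕜] X} {x x' y y' : X}
    (h : HasStrongDerivAtZero S x y) (h' : HasStrongDerivAtZero S x' y') :
    HasStrongDerivAtZero S (x + x') (y + y') := by
  refine (Tendsto.add h h').congr fun r => ?_
  rw [map_add, map_add, ← smul_add]
  congr 1
  abel

theorem HasStrongDerivAtZero.smul {S : ℝ≥0 → X →L[𝕜] X} {x y : X} (c : 𝕜)
    (h : HasStrongDerivAtZero S x y) : HasStrongDerivAtZero S (c • x) (c • y) := by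
  refine (Tendsto.const_smul h c).congr fun r => ?_
  rw [map_smul, map_smul, ← smul_sub, smul_comm]

theorem HasStrongDerivAtZero.zero (S : ℝ≥0 → X →L[𝕜] X) : HasStrongDerivAtZero S 0 0 := by
  simp [HasStrongDerivAtZero]

/-- The strong derivative `S'(0)` of `S : [0, ∞) → L(X)` at the point `0`, as an (in general
unbounded) linear operator: its domain is the set of all `x` for which the limit of
`h⁻¹ (S(h) x - S(0) x)` as `h → 0` exists, and its value at `x` is that limit. -/
def strongDerivAtZero (S : ℝ≥0 → X →L[𝕜] X) : X →ₗ.[𝕜] X where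
  domain :=
    { carrier := {x | ∃ y, HasStrongDerivAtZero S x y}
      add_mem' := fun ⟨y, hy⟩ ⟨z, hz⟩ => ⟨y + z, hy.add hz⟩
      zero_mem' := ⟨0, HasStrongDerivAtZero.zero S⟩
      smul_mem' := fun c _ ⟨y, hy⟩ => ⟨c • y, hy.smul c⟩ }
  toFun :=
    { toFun := fun x => x.2.choose
      map_add' := fun x y =>
        (x + y).2.choose_spec.unique (x.2.choose_spec.add y.2.choose_spec)
      map_smul' := fun c x => (c • x).2.choose_spec.unique (x.2.choose_spec.smul c) }

theorem strongDerivAtZero_spec (S : ℝ≥0 → X →L[𝕜] X) (x : (strongDerivAtZero S).domain) :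
    HasStrongDerivAtZero S (x : X) (strongDerivAtZero S x) :=
  x.2.choose_spec

/-- `T : [0, ∞) → L(X)` is a `C₀`-semigroup. Continuity is with respect to the strong operator
topology. -/
structure IsC0Semigroup (T : ℝ≥0 → X →L[𝕜] X) : Prop where
  map_zero : T 0 = ContinuousLinearMap.id 𝕜 X
  map_add : ∀ l m : ℝ≥0, T (l + m) = (T l).comp (T m)
  continuous_apply : ∀ x : X, Continuous fun s : ℝ≥0 => T s x
  exp_bound : ∃ M a : ℝ, 1 ≤ M ∧ ∀ s : ℝ≥0, ‖T s‖ ≤ M * Real.exp (a * s)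

/-- `A` is the generator of the `C₀`-semigroup `T`. In this case `T s = exp (s A)`. -/
def IsGeneratorOf (A : X →ₗ.[𝕜] X) (T : ℝ≥0 → X →L[𝕜] X) : Prop :=
  IsC0Semigroup T ∧ A = strongDerivAtZero T

/-- `A` is the generator of some `C₀`-semigroup. -/
def IsC0Generator (A : X →ₗ.[𝕜] X) : Prop :=
  ∃ T : ℝ≥0 → X →L[𝕜] X, IsGeneratorOf A T

/-- A set is precompact if its closure is compact. -/
def IsPrecompactSet (K : Set X) : Prop := IsCompact (closure K)

/-- There is a dense linear subspace `A ⊆ D(Z)` such that for all `f ∈ A` and `s ≥ 0` there is a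
sequence `u₁, u₂, …` in `D(Z)` with `‖F(t/n)^[n s] f - uₙ‖ → 0` and with `{uₙ : n ≥ 1}` and
`{Z uₙ : n ≥ 1}` precompact. Here `[n s]` is the integer part of `n s`. -/
def HasPrecompactApproximation (F : ℝ≥0 → X →L[𝕜] X) (Z : X →ₗ.[𝕜] X) (t : ℝ≥0) : Prop :=
  ∃ A : Submodule 𝕜 X, A ≤ Z.domain ∧ Dense (A : Set X) ∧
    ∀ f ∈ A, ∀ s : ℝ≥0, ∃ u : ℕ → Z.domain,
      Tendsto (fun n : ℕ => ‖(F (t / n) ^ ⌊(n : ℝ≥0) * s⌋₊) f - (u n : X)‖) atTop (𝓝 0) ∧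
      IsPrecompactSet ((fun n => (u n : X)) '' Set.Ici 1) ∧
      IsPrecompactSet ((fun n => Z (u n)) '' Set.Ici 1)

end

/-! Put `F r = expC r ∘ expD r` and `Z = C + D`. The discrete semigroups `F r ^ ⌊τ / r⌋₊` are
uniformly bounded for bounded `τ` and, as `r → 0`, asymptotically equicontinuous in `τ` on each
vector. On the closure of the graph of `Z` their first-order behaviour at `τ = 0` is asymptotically
that of a semigroup whose generator extends `Z` (`exists_norm_floor_sub_le`).

From `(*)` to generation: along an ultrafilter finer than `n → ∞`, precompactness makes `f_n^s` and
`Z f_n^s` converge, and their limits form a point of the closed graph of `Z`. So `F(t/n)^[nτ/t] f`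
converges for `f ∈ A`, hence for all `f`, to a C₀-semigroup `U` whose generator extends the closed
graph of `Z`; moreover every `U s f` with `f ∈ A` is a first coordinate of that graph. A core
argument (`graph_le_of_dense`) then forces equality, which gives closability as well.

Conversely, if the closure generates `U`, Chernoff's formula gives convergence of the orbits to `U
(t * s) f`, which lies in the domain of the closure for `f ∈ D(Z)`; a sequence approximating it in
graph norm serves as `f_n^s`. Chernoff's formula is proved by continuous induction on time
(`tendsto_of_mem_domain`) and also yields the final product formula. -/

noncomputable section

/-! ### Uniform estimates for the discrete semigroups -/

section Estimates

variable {𝕜 X : Type*} [RCLike 𝕜] [NormedAddCommGroup X] [NormedSpace 𝕜 X]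

/-- The hypotheses of Chernoff's theorem, without the range condition: `F` is a stable family of
operators with `F 0 = 1` whose strong derivative at `0` extends the densely defined operator `Z`. -/
structure StableConsistent (F : ℝ≥0 → X →L[𝕜] X) (Z : X →ₗ.[𝕜] X) (M a : ℝ) : Prop where
  one_le : 1 ≤ M
  nonneg : 0 ≤ a
  bound : ∀ (r : ℝ≥0) (m : ℕ), ‖F r ^ m‖ ≤ M * Real.exp (a * (m * r))
  zero : F 0 = 1
  dense : Dense (Z.domain : Set X)
  deriv : ∀ x : Z.domain, HasStrongDerivAtZero F (x : X) (Z x)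

namespace StableConsistent

variable {F : ℝ≥0 → X →L[𝕜] X} {Z : X →ₗ.[𝕜] X} {M a : ℝ}

theorem pos (h : StableConsistent F Z M a) (T : ℝ) : 0 < M * Real.exp (a * T) :=
  mul_pos (zero_lt_one.trans_le h.one_le) (Real.exp_pos _)

theorem norm_pow_le (h : StableConsistent F Z M a) {T : ℝ} {r : ℝ≥0} {m : ℕ}
    (hm : (m : ℝ) * r ≤ T) : ‖F r ^ m‖ ≤ M * Real.exp (a * T) := by
  refine (h.bound r m).trans ?_
  have := h.one_le
  have := h.nonneg
  gcongr

theorem norm_pow_apply_le (h : StableConsistent F Z M a) {T : ℝ} {r : ℝ≥0} {m : ℕ}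
    (hm : (m : ℝ) * r ≤ T) (x : X) : ‖(F r ^ m) x‖ ≤ M * Real.exp (a * T) * ‖x‖ :=
  (F r ^ m).le_of_opNorm_le (h.norm_pow_le hm) x

theorem floor_mul_le (τ r : ℝ≥0) : ((⌊τ / r⌋₊ : ℕ) : ℝ) * r ≤ τ := by
  rcases eq_or_ne r 0 with rfl | hr
  · simp
  · have := mul_le_mul_left (Nat.floor_le (zero_le (a := τ / r))) r
    rw [div_mul_cancel₀ _ hr] at this
    exact_mod_cast this

theorem lt_floor_mul_add {τ r : ℝ≥0} (hr : r ≠ 0) :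
    (τ : ℝ) < ((⌊τ / r⌋₊ : ℕ) : ℝ) * r + r := by
  have h1 := Nat.lt_floor_add_one (τ / r)
  have h2 : τ < (⌊τ / r⌋₊ + 1) * r := by
    rwa [div_lt_iff₀ (pos_iff_ne_zero.2 hr)] at h1
  have h3 : (τ : ℝ) < ((⌊τ / r⌋₊ : ℕ) + 1) * r := by exact_mod_cast h2
  linarith

theorem pow_sub_one_apply (S : X →L[𝕜] X) (x : X) (k : ℕ) :
    (S ^ k) x - x = ∑ j ∈ Finset.range k, (S ^ j) (S x - x) := by
  have : ∀ j, (S ^ j) (S x - x) = (S ^ (j + 1)) x - (S ^ j) x := fun j => by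
    rw [map_sub, pow_succ]; rfl
  simp_rw [this]
  rw [Finset.sum_range_sub (fun j => (S ^ j) x)]
  simp

/-- The basic local estimate, in terms of the difference quotient at `x`. -/
theorem norm_pow_sub_le (h : StableConsistent F Z M a) {T : ℝ} {r : ℝ≥0} (hr : r ≠ 0) {k : ℕ}
    (hk : (k : ℝ) * r ≤ T) (x y : X) {η : ℝ} (hη : ∀ j < k, ‖(F r ^ j) y - y‖ ≤ η) :
    ‖(F r ^ k) x - x - (((k * r : ℝ≥0) : ℝ) : 𝕜) • y‖ ≤
      k * r * (M * Real.exp (a * T) * ‖(((r : ℝ) : 𝕜))⁻¹ • (F r x - F 0 x) - y‖ + η) := by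
  set z := (((r : ℝ) : 𝕜))⁻¹ • (F r x - F 0 x) with hz
  have hr' : ((r : ℝ) : 𝕜) ≠ 0 := by exact_mod_cast hr
  have hFz : F r x - x = ((r : ℝ) : 𝕜) • z := by
    rw [hz, smul_inv_smul₀ hr', h.zero]; rfl
  -- Telescope `F^k x - x` into the sum of `F^j (F x - x)`, with `F x - x = r z`, and split `z = (z
  -- - y) + y`: stability controls the first part, `η` the second.
  have key : (F r ^ k) x - x - (((k * r : ℝ≥0) : ℝ) : 𝕜) • y =
      ((r : ℝ) : 𝕜) • ∑ j ∈ Finset.range k, ((F r ^ j) (z - y) + ((F r ^ j) y - y)) := by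
    rw [pow_sub_one_apply, hFz]
    simp only [map_smul, map_sub, sub_add_sub_cancel]
    rw [Finset.sum_sub_distrib, smul_sub, Finset.smul_sum]
    congr 1
    rw [Finset.sum_const, Finset.card_range, ← Nat.cast_smul_eq_nsmul 𝕜, smul_smul]
    congr 1
    push_cast
    ring
  rw [key, norm_smul, RCLike.norm_ofReal, NNReal.abs_eq]
  have hs : ‖∑ j ∈ Finset.range k, ((F r ^ j) (z - y) + ((F r ^ j) y - y))‖ ≤
      ∑ j ∈ Finset.range k, (M * Real.exp (a * T) * ‖z - y‖ + η) := by
    refine norm_sum_le_of_le _ fun j hj => (norm_add_le _ _).trans ?_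
    have hj' := Finset.mem_range.1 hj
    refine add_le_add (h.norm_pow_apply_le ?_ _) (hη j hj')
    refine le_trans ?_ hk
    gcongr
  rw [Finset.sum_const, Finset.card_range, nsmul_eq_mul] at hs
  calc _ ≤ (r : ℝ) * (k * (M * Real.exp (a * T) * ‖z - y‖ + η)) := by gcongr
    _ = _ := by ring

/-- On the domain of `Z` the difference quotients stay bounded, so `j` steps move a vector by `O(j
r)`; density and stability extend the smallness to all vectors. -/
theorem exists_norm_pow_sub_self_le (h : StableConsistent F Z M a) (x : X) {ε : ℝ} (hε : 0 < ε) :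
    ∃ δ > (0 : ℝ), ∀ᶠ r : ℝ≥0 in 𝓝[>] 0, ∀ j : ℕ, (j : ℝ) * r ≤ δ →
      ‖(F r ^ j) x - x‖ ≤ ε := by
  set M' := M * Real.exp (a * 1) with hM'
  have hM'0 : 0 < M' := h.pos 1
  obtain ⟨d, hd, hxd⟩ : ∃ d ∈ (Z.domain : Set X), ‖x - d‖ < ε / (2 * (M' + 1)) := by
    obtain ⟨d, hd, hd'⟩ := h.dense.exists_dist_lt x (ε := ε / (2 * (M' + 1))) (by positivity)
    exact ⟨d, hd, by rwa [← dist_eq_norm]⟩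
  have hlim := h.deriv ⟨d, hd⟩
  set y := Z ⟨d, hd⟩
  have hb : ∀ᶠ r : ℝ≥0 in 𝓝[>] 0, ‖(((r : ℝ) : 𝕜))⁻¹ • (F r d - F 0 d) - 0‖ < ‖y‖ + 1 := by
    have := (hlim.norm).eventually (gt_mem_nhds (lt_add_one ‖y‖))
    simpa using this
  refine ⟨min 1 (ε / (2 * M' * (‖y‖ + 1))), by positivity, ?_⟩
  filter_upwards [hb, self_mem_nhdsWithin] with r hr hr0 j hj
  have hj1 := hj.trans (min_le_left _ _)
  have h1 := h.norm_pow_sub_le (ne_of_gt hr0) hj1 d 0 (η := 0) (by simp)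
  rw [smul_zero, sub_zero, add_zero] at h1
  have h2 : ‖(F r ^ j) d - d‖ ≤ ε / 2 := by
    refine h1.trans ?_
    calc (j : ℝ) * r * (M * Real.exp (a * 1) * ‖(((r : ℝ) : 𝕜))⁻¹ • (F r d - F 0 d) - 0‖)
        ≤ (ε / (2 * M' * (‖y‖ + 1))) * (M' * (‖y‖ + 1)) := by
          have := hj.trans (min_le_right _ _)
          gcongr
      _ = ε / 2 := by
          have : ‖y‖ + 1 ≠ 0 := by positivity
          field_simp
  have h3 : (F r ^ j) x - x = (F r ^ j) (x - d) + ((F r ^ j) d - d) - (x - d) := by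
    rw [map_sub]; abel
  rw [h3]
  calc _ ≤ ‖(F r ^ j) (x - d)‖ + ‖(F r ^ j) d - d‖ + ‖x - d‖ :=
        (norm_sub_le _ _).trans (add_le_add_left (norm_add_le _ _) _)
    _ ≤ M' * ‖x - d‖ + ε / 2 + ‖x - d‖ := by
        gcongr
        exact h.norm_pow_apply_le hj1 _
    _ = (M' + 1) * ‖x - d‖ + ε / 2 := by ring
    _ ≤ (M' + 1) * (ε / (2 * (M' + 1))) + ε / 2 := by gcongr
    _ = ε := by field_simp; ring

theorem exists_norm_pow_sub_pow_le (h : StableConsistent F Z M a) (x : X) (T : ℝ) {ε : ℝ}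
    (hε : 0 < ε) :
    ∃ δ > (0 : ℝ), ∀ᶠ r : ℝ≥0 in 𝓝[>] 0, ∀ k k' : ℕ, (k : ℝ) * r ≤ T → (k' : ℝ) * r ≤ T →
      |(k : ℝ) * r - k' * r| ≤ δ → ‖(F r ^ k) x - (F r ^ k') x‖ ≤ ε := by
  have hM' := h.pos T
  set M' := M * Real.exp (a * T)
  obtain ⟨δ, hδ, hev⟩ := h.exists_norm_pow_sub_self_le x (ε := ε / M') (by positivity)
  refine ⟨δ, hδ, ?_⟩
  filter_upwards [hev] with r hr
  have main : ∀ k j : ℕ, (k : ℝ) * r ≤ T → (j : ℝ) * r ≤ δ →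
      ‖(F r ^ (k + j)) x - (F r ^ k) x‖ ≤ ε := fun k j hk hj => by
    have : (F r ^ (k + j)) x - (F r ^ k) x = (F r ^ k) ((F r ^ j) x - x) := by
      rw [map_sub, pow_add]; rfl
    rw [this]
    calc _ ≤ M' * ‖(F r ^ j) x - x‖ := h.norm_pow_apply_le hk _
      _ ≤ M' * (ε / M') := by gcongr; exact hr j hj
      _ = ε := by field_simp
  intro k k' hk hk' hkk
  rcases le_total k' k with hle | hle
  · obtain ⟨j, rfl⟩ := Nat.exists_eq_add_of_le hle
    refine main k' j hk' ((le_abs_self _).trans (le_trans (le_of_eq ?_) hkk))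
    push_cast; congr 1; ring
  · obtain ⟨j, rfl⟩ := Nat.exists_eq_add_of_le hle
    rw [norm_sub_rev]
    rw [abs_sub_comm] at hkk
    refine main k j hk ((le_abs_self _).trans (le_trans (le_of_eq ?_) hkk))
    push_cast; congr 1; ring

theorem eventually_le_of_pos {δ : ℝ} (hδ : 0 < δ) : ∀ᶠ r : ℝ≥0 in 𝓝[>] 0, (r : ℝ) ≤ δ := by
  have : Tendsto (fun r : ℝ≥0 => (r : ℝ)) (𝓝[>] 0) (𝓝 ((0 : ℝ≥0) : ℝ)) :=
    (NNReal.continuous_coe.tendsto 0).mono_left nhdsWithin_le_nhds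
  exact (this.eventually (gt_mem_nhds (by simpa using hδ))).mono fun _ => le_of_lt

theorem exists_norm_floor_sub_floor_le (h : StableConsistent F Z M a) (x : X) (T : ℝ) {ε : ℝ}
    (hε : 0 < ε) :
    ∃ δ > (0 : ℝ), ∀ σ τ : ℝ≥0, (σ : ℝ) ≤ T → (τ : ℝ) ≤ T → dist σ τ ≤ δ →
      ∀ᶠ r : ℝ≥0 in 𝓝[>] 0, ‖(F r ^ ⌊σ / r⌋₊) x - (F r ^ ⌊τ / r⌋₊) x‖ ≤ ε := by
  obtain ⟨δ, hδ, hev⟩ := h.exists_norm_pow_sub_pow_le x T hε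
  refine ⟨δ / 2, by positivity, fun σ τ hσ hτ hd => ?_⟩
  filter_upwards [hev, eventually_le_of_pos (half_pos hδ), self_mem_nhdsWithin] with r hr hrδ hr0
  have hr0 : r ≠ 0 := ne_of_gt hr0
  refine hr _ _ ((floor_mul_le σ r).trans hσ) ((floor_mul_le τ r).trans hτ) ?_
  rw [NNReal.dist_eq] at hd
  have h1 := floor_mul_le σ r
  have h2 := floor_mul_le τ r
  have h3 := lt_floor_mul_add (τ := σ) hr0
  have h4 := lt_floor_mul_add (τ := τ) hr0
  rw [abs_le] at hd ⊢
  constructor <;> linarith [hd.1, hd.2]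

/-- The two total exponents differ by at most one, a time shift of at most `r`, which equicontinuity
absorbs. This is the source of the semigroup law in the limit. -/
theorem tendsto_floor_add (h : StableConsistent F Z M a) (x : X) (σ τ : ℝ≥0) :
    Tendsto (fun r : ℝ≥0 => (F r ^ ⌊σ / r⌋₊) ((F r ^ ⌊τ / r⌋₊) x) - (F r ^ ⌊(σ + τ) / r⌋₊) x)
      (𝓝[>] 0) (𝓝 0) := by
  rw [Metric.tendsto_nhds]
  intro ε hε
  obtain ⟨δ, hδ, hev⟩ := h.exists_norm_pow_sub_pow_le x (σ + τ) (half_pos hε)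
  filter_upwards [hev, eventually_le_of_pos (half_pos hδ), self_mem_nhdsWithin] with r hr hrδ hr0
  have hr0 : r ≠ 0 := ne_of_gt hr0
  have h1 := floor_mul_le σ r
  have h2 := floor_mul_le τ r
  have h3 := lt_floor_mul_add (τ := σ) hr0
  have h4 := lt_floor_mul_add (τ := τ) hr0
  have h5 := floor_mul_le (σ + τ) r
  have h6 := lt_floor_mul_add (τ := σ + τ) hr0
  push_cast at h5 h6
  have := hr (⌊σ / r⌋₊ + ⌊τ / r⌋₊) ⌊(σ + τ) / r⌋₊ (by push_cast; linarith) h5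
    (by push_cast; rw [abs_le]; constructor <;> linarith)
  rw [dist_zero_right]
  rw [pow_add] at this
  exact this.trans_lt (half_lt_self hε)

theorem tendsto_floor_zero (τ : ℝ≥0) :
    Tendsto (fun r : ℝ≥0 => (((⌊τ / r⌋₊ * r : ℝ≥0) : ℝ) : 𝕜)) (𝓝[>] 0) (𝓝 ((τ : ℝ) : 𝕜)) := by
  refine (RCLike.continuous_ofReal.tendsto _).comp ?_
  rw [Metric.tendsto_nhds]
  intro ε hε
  filter_upwards [eventually_le_of_pos (half_pos hε), self_mem_nhdsWithin] with r hr hr0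
  have h1 := floor_mul_le τ r
  have h2 := lt_floor_mul_add (τ := τ) (ne_of_gt hr0)
  rw [Real.dist_eq, abs_lt]
  push_cast
  constructor <;> linarith

/-- For `(g, y)` in the closure of the graph of `Z`, the orbits of `g` under the discrete
semigroups are differentiable at `0` with derivative `y`, asymptotically as `r → 0`. -/
theorem exists_norm_floor_sub_le (h : StableConsistent F Z M a) {g y : X}
    (hgy : (g, y) ∈ Z.graph.topologicalClosure) {ε : ℝ} (hε : 0 < ε) :
    ∃ δ > (0 : ℝ), ∀ τ : ℝ≥0, (τ : ℝ) ≤ δ → ∀ η > 0, ∀ᶠ r : ℝ≥0 in 𝓝[>] 0,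
      ‖(F r ^ ⌊τ / r⌋₊) g - g - ((τ : ℝ) : 𝕜) • y‖ ≤ ε * τ + η := by
  obtain ⟨δ, hδ, hev⟩ := h.exists_norm_pow_sub_self_le y (half_pos hε)
  refine ⟨δ, hδ, fun τ hτ η hη => ?_⟩
  have hM' := h.pos τ
  set M' := M * Real.exp (a * τ) with hM'def
  -- `δ` depends only on `y` and `ε`, so the graph point approximating `(g, y)` may be chosen after
  -- `τ` and `η`. Its error `κ` in `y` is absorbed into `ε * τ`, its error in `g` into `η`.
  obtain ⟨κ, hκ, hκ1, hκ2⟩ : ∃ κ > (0 : ℝ), M' * (2 * κ) ≤ ε / 2 ∧ (M' + 1) * κ ≤ η / 2 := by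
    refine ⟨min (ε / 2 / (M' * 2)) (η / 2 / (M' + 1)), by positivity, ?_, ?_⟩
    · have := (le_div_iff₀ (by positivity)).1 (min_le_left (ε / 2 / (M' * 2)) (η / 2 / (M' + 1)))
      linarith
    · have := (le_div_iff₀ (by positivity)).1 (min_le_right (ε / 2 / (M' * 2)) (η / 2 / (M' + 1)))
      linarith
  obtain ⟨p, hp, hpd⟩ := Metric.mem_closure_iff.1 hgy κ hκ
  obtain ⟨x, hx1, hx2⟩ := (LinearPMap.mem_graph_iff Z).1 hp
  rw [Prod.dist_eq, max_lt_iff, dist_eq_norm, dist_eq_norm, ← hx1, ← hx2] at hpd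
  obtain ⟨hgx, hyx⟩ := hpd
  dsimp only at hgx hyx
  have hq : ∀ᶠ r : ℝ≥0 in 𝓝[>] 0,
      ‖(((r : ℝ) : 𝕜))⁻¹ • (F r x - F 0 x) - Z x‖ < κ := by
    have := (Metric.tendsto_nhds.1 (h.deriv x)) κ hκ
    simpa [dist_eq_norm] using this
  have hs : ∀ᶠ r : ℝ≥0 in 𝓝[>] 0,
      ‖((((⌊τ / r⌋₊ * r : ℝ≥0) : ℝ) : 𝕜)) • y - ((τ : ℝ) : 𝕜) • y‖ < η / 2 := by
    have := Metric.tendsto_nhds.1 ((tendsto_floor_zero (𝕜 := 𝕜) τ).smul_const y) (η / 2)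
      (half_pos hη)
    simpa only [dist_eq_norm] using this
  filter_upwards [hev, hq, hs, self_mem_nhdsWithin] with r hr hq hs hr0
  have hr0 : r ≠ 0 := ne_of_gt hr0
  have hfl := floor_mul_le τ r
  set k := ⌊τ / r⌋₊
  have h1 := h.norm_pow_sub_le hr0 hfl (x : X) y (η := ε / 2) fun j hj => hr j (by
    refine le_trans ?_ (hfl.trans hτ)
    gcongr)
  have h2 : ‖(((r : ℝ) : 𝕜))⁻¹ • (F r x - F 0 x) - y‖ ≤ 2 * κ := by
    have := norm_sub_le_norm_sub_add_norm_sub ((((r : ℝ) : 𝕜))⁻¹ • (F r x - F 0 x)) (Z x) y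
    rw [norm_sub_rev (Z x)] at this
    linarith
  have h3 : ‖(F r ^ k) (x : X) - x - (((k * r : ℝ≥0) : ℝ) : 𝕜) • y‖ ≤ τ * ε := by
    refine h1.trans ?_
    calc _ ≤ (τ : ℝ) * (M' * (2 * κ) + ε / 2) := by gcongr
      _ ≤ τ * ε := by gcongr; linarith
  have h4 : (F r ^ k) g - g - ((τ : ℝ) : 𝕜) • y =
      ((F r ^ k) (x : X) - x - (((k * r : ℝ≥0) : ℝ) : 𝕜) • y) + ((F r ^ k) (g - x) - (g - x)) +
        ((((k * r : ℝ≥0) : ℝ) : 𝕜) • y - ((τ : ℝ) : 𝕜) • y) := by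
    rw [map_sub]; abel
  have h5 : ‖(F r ^ k) (g - x) - (g - x)‖ ≤ η / 2 := by
    have := h.norm_pow_apply_le hfl (g - x)
    calc _ ≤ M' * ‖g - x‖ + ‖g - x‖ := (norm_sub_le _ _).trans (add_le_add_left this _)
      _ = (M' + 1) * ‖g - x‖ := by ring
      _ ≤ (M' + 1) * κ := by gcongr
      _ ≤ η / 2 := hκ2
  rw [h4]
  refine (norm_add₃_le).trans ?_
  linarith

/-- Convergence on a dense set extends to the whole space. -/
theorem tendsto_of_dense (h : StableConsistent F Z M a) {l : Filter ℝ≥0} {s : Set X} (hs : Dense s)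
    {τ : ℝ≥0} {V : X →L[𝕜] X}
    (hV : ∀ x ∈ s, Tendsto (fun r : ℝ≥0 => (F r ^ ⌊τ / r⌋₊) x) l (𝓝 (V x))) (x : X) :
    Tendsto (fun r : ℝ≥0 => (F r ^ ⌊τ / r⌋₊) x) l (𝓝 (V x)) := by
  have hM' := h.pos τ
  set M' := M * Real.exp (a * τ) with hM'def
  rw [Metric.tendsto_nhds]
  intro ε hε
  obtain ⟨d, hd, hxd⟩ := hs.exists_dist_lt x (ε := ε / 2 / (M' + ‖V‖ + 1)) (by positivity)
  filter_upwards [Metric.tendsto_nhds.1 (hV d hd) (ε / 2) (half_pos hε)] with r hr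
  rw [dist_eq_norm] at hr hxd ⊢
  have h1 : (F r ^ ⌊τ / r⌋₊) x - V x =
      (F r ^ ⌊τ / r⌋₊) (x - d) + ((F r ^ ⌊τ / r⌋₊) d - V d) - V (x - d) := by
    rw [map_sub, map_sub]; abel
  have h2 := h.norm_pow_apply_le (floor_mul_le τ r) (x - d)
  have h3 := V.le_opNorm (x - d)
  have h4 : (M' + ‖V‖ + 1) * ‖x - d‖ < ε / 2 := by
    rwa [lt_div_iff₀ (by positivity), mul_comm] at hxd
  rw [h1]
  have h5 := (norm_sub_le ((F r ^ ⌊τ / r⌋₊) (x - d) + ((F r ^ ⌊τ / r⌋₊) d - V d))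
    (V (x - d))).trans (add_le_add_left (norm_add_le _ _) _)
  nlinarith [norm_nonneg (x - d)]

end StableConsistent

end Estimates

/-! ### Chernoff's product formula -/

section Chernoff

variable {𝕜 X : Type*} [RCLike 𝕜] [NormedAddCommGroup X] [NormedSpace 𝕜 X]

theorem mem_graph_strongDerivAtZero {S : ℝ≥0 → X →L[𝕜] X} {x y : X} :
    (x, y) ∈ (strongDerivAtZero S).graph ↔ HasStrongDerivAtZero S x y := by
  rw [LinearPMap.mem_graph_iff]
  constructor
  · rintro ⟨z, rfl, rfl⟩
    exact strongDerivAtZero_spec S z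
  · intro h
    exact ⟨⟨x, y, h⟩, rfl, (strongDerivAtZero_spec S ⟨x, y, h⟩).unique h⟩

theorem IsC0Semigroup.hasStrongDerivAtZero_apply {U : ℝ≥0 → X →L[𝕜] X} (hU : IsC0Semigroup U)
    {x y : X} (h : HasStrongDerivAtZero U x y) (s : ℝ≥0) :
    HasStrongDerivAtZero U (U s x) (U s y) := by
  refine (((U s).continuous.tendsto y).comp h).congr fun r => ?_
  have h1 : U r (U s x) = U s (U r x) := by
    rw [← ContinuousLinearMap.comp_apply, ← ContinuousLinearMap.comp_apply, ← hU.map_add,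
      ← hU.map_add, add_comm]
  simp only [Function.comp_apply, map_smul, map_sub, hU.map_zero, h1,
    ContinuousLinearMap.id_apply]

theorem HasStrongDerivAtZero.exists_norm_sub_le {S : ℝ≥0 → X →L[𝕜] X} (hS : S 0 = 1) {x y : X}
    (h : HasStrongDerivAtZero S x y) {ε : ℝ} (hε : 0 < ε) :
    ∃ δ > (0 : ℝ), ∀ τ : ℝ≥0, (τ : ℝ) ≤ δ → ‖S τ x - x - ((τ : ℝ) : 𝕜) • y‖ ≤ ε * τ := by
  have h1 := Metric.tendsto_nhds.1 h ε hε
  rw [eventually_nhdsWithin_iff, Metric.eventually_nhds_iff] at h1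
  obtain ⟨δ, hδ, h1⟩ := h1
  refine ⟨δ / 2, half_pos hδ, fun τ hτ => ?_⟩
  rcases eq_or_ne τ 0 with rfl | hτ0
  · simp [hS]
  have h2 := h1 (y := τ) (by rw [NNReal.dist_eq]; simp; linarith) (pos_iff_ne_zero.2 hτ0)
  have hτ' : ((τ : ℝ) : 𝕜) ≠ 0 := by exact_mod_cast hτ0
  have h3 : S τ x - x - ((τ : ℝ) : 𝕜) • y =
      ((τ : ℝ) : 𝕜) • ((((τ : ℝ) : 𝕜))⁻¹ • (S τ x - S 0 x) - y) := by
    rw [smul_sub, smul_inv_smul₀ hτ', hS]; rfl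
  rw [h3, norm_smul, RCLike.norm_ofReal, NNReal.abs_eq, mul_comm]
  rw [dist_eq_norm] at h2
  gcongr

theorem hasStrongDerivAtZero_of_exists_norm_sub_le {S : ℝ≥0 → X →L[𝕜] X} (hS : S 0 = 1) {x y : X}
    (h : ∀ ε > (0 : ℝ), ∃ δ > (0 : ℝ), ∀ τ : ℝ≥0, (τ : ℝ) ≤ δ →
      ‖S τ x - x - ((τ : ℝ) : 𝕜) • y‖ ≤ ε * τ) : HasStrongDerivAtZero S x y := by
  refine Metric.tendsto_nhds.2 fun ε hε => ?_
  obtain ⟨δ, hδ, h⟩ := h (ε / 2) (half_pos hε)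
  filter_upwards [StableConsistent.eventually_le_of_pos hδ, self_mem_nhdsWithin] with τ hτ hτ0
  have hτ0 : 0 < (τ : ℝ) := hτ0
  have hτ' : ((τ : ℝ) : 𝕜) ≠ 0 := by exact_mod_cast hτ0.ne'
  have h3 : (((τ : ℝ) : 𝕜))⁻¹ • (S τ x - S 0 x) - y =
      (((τ : ℝ) : 𝕜))⁻¹ • (S τ x - x - ((τ : ℝ) : 𝕜) • y) := by
    rw [smul_sub _ (S τ x - x), inv_smul_smul₀ hτ', hS]; rfl
  rw [dist_eq_norm, h3, norm_smul, norm_inv, RCLike.norm_ofReal, NNReal.abs_eq,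
    inv_mul_lt_iff₀ hτ0]
  refine (h τ hτ).trans_lt ?_
  nlinarith

namespace StableConsistent

variable {F : ℝ≥0 → X →L[𝕜] X} {Z : X →ₗ.[𝕜] X} {M a : ℝ}

/-- Chernoff's product formula for vectors in the domain of the generator. -/
theorem tendsto_of_mem_domain (h : StableConsistent F Z M a) {U : ℝ≥0 → X →L[𝕜] X}
    (hU : IsC0Semigroup U) (hUZ : (strongDerivAtZero U).graph ≤ Z.graph.topologicalClosure)
    (T : ℝ≥0) {f : X} (hf : f ∈ (strongDerivAtZero U).domain) :
    Tendsto (fun r : ℝ≥0 => (F r ^ ⌊T / r⌋₊) f) (𝓝[>] 0) (𝓝 (U T f)) := by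
  obtain ⟨b, hb⟩ := hf
  have hM' := h.pos T
  set M' := M * Real.exp (a * T) with hM'def
  -- Continuous induction on `s ∈ [0, T]`: run `U` for time `s`, then the discrete semigroup for
  -- time `T - s`, and let the asymptotic error grow at rate at most `ε`. At `s = T` the remaining
  -- power is trivial.
  have key : ∀ ε > (0 : ℝ), T ∈ {s : ℝ≥0 | ∀ η > (0 : ℝ), ∀ᶠ r : ℝ≥0 in 𝓝[>] 0,
      ‖(F r ^ ⌊(T - s) / r⌋₊) (U s f) - (F r ^ ⌊T / r⌋₊) f‖ ≤ ε * s + η} := by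
    intro ε hε
    refine IsClosed.Icc_subset_of_forall_exists_gt (a := 0) (b := T) ?_ ?_ ?_
      (Set.right_mem_Icc.2 zero_le)
    -- Closedness: pass to a nearby `s'`, using continuity of `s ↦ U s f` and equicontinuity of the
    -- discrete orbits.
    · refine isClosed_of_closure_subset fun s hs => ⟨?_, ?_⟩
      · intro η hη
        have hTs : ∀ s : ℝ≥0, ((T - s : ℝ≥0) : ℝ) ≤ T := fun s =>
          NNReal.coe_le_coe.2 tsub_le_self
        obtain ⟨δ, hδ, hfl⟩ := h.exists_norm_floor_sub_floor_le (U s f) T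
          (ε := η / 4) (by positivity)
        have hc1 : ∀ᶠ s' in 𝓝 s, dist (T - s) (T - s') < δ := by
          have hc : Continuous fun s' : ℝ≥0 => dist (T - s) (T - s') := by fun_prop
          exact hc.continuousAt.eventually (gt_mem_nhds (by simpa using hδ))
        have hc2 : ∀ᶠ s' in 𝓝 s, dist (U s' f) (U s f) < η / (4 * M') :=
          Metric.tendsto_nhds.1 ((hU.continuous_apply f).tendsto s) _ (by positivity)
        have hc3 : ∀ᶠ s' : ℝ≥0 in 𝓝 s, ε * (s' : ℝ) < ε * s + η / 4 := by
          have hc : Continuous fun s' : ℝ≥0 => ε * (s' : ℝ) := by fun_prop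
          exact hc.continuousAt.eventually (gt_mem_nhds (by linarith))
        obtain ⟨s', ⟨hs'1, hs'2, hs'3⟩, hs', -⟩ :=
          mem_closure_iff_nhds.1 hs _ (hc1.and (hc2.and hc3))
        filter_upwards [hs' (η / 4) (by positivity), hfl _ _ (hTs s) (hTs s') hs'1.le]
          with r hr1 hr2
        have h1 : (F r ^ ⌊(T - s) / r⌋₊) (U s f) - (F r ^ ⌊T / r⌋₊) f =
            ((F r ^ ⌊(T - s) / r⌋₊) (U s f) - (F r ^ ⌊(T - s') / r⌋₊) (U s f)) +
            -((F r ^ ⌊(T - s') / r⌋₊) (U s' f - U s f)) +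
            ((F r ^ ⌊(T - s') / r⌋₊) (U s' f) - (F r ^ ⌊T / r⌋₊) f) := by
          rw [map_sub]; abel
        have h2 : ‖-((F r ^ ⌊(T - s') / r⌋₊) (U s' f - U s f))‖ ≤ η / 4 := by
          rw [norm_neg]
          refine (h.norm_pow_apply_le ((floor_mul_le (T - s') r).trans (hTs s')) _).trans ?_
          rw [dist_eq_norm] at hs'2
          calc _ ≤ M' * (η / (4 * M')) := by gcongr
            _ = η / 4 := by field_simp
        rw [h1]
        refine norm_add₃_le.trans ?_
        linarith
      · exact closure_minimal Set.inter_subset_right isClosed_Icc hs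
    · intro η hη
      refine Eventually.of_forall fun r => ?_
      simp [hU.map_zero, hη.le]
    · rintro s ⟨hs, hs0, hsT⟩ y hy
      have hy : s < y := hy
      set g := U s f with hg
      have hgd : HasStrongDerivAtZero U g (U s b) := hU.hasStrongDerivAtZero_apply hb s
      have hgG := hUZ (mem_graph_strongDerivAtZero.2 hgd)
      have hε' : 0 < ε / (2 * M') := by positivity
      obtain ⟨δ₁, hδ₁, h₁⟩ := hgd.exists_norm_sub_le hU.map_zero hε'
      obtain ⟨δ₂, hδ₂, h₂⟩ := h.exists_norm_floor_sub_le hgG hε'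
      obtain ⟨τ, hτ0, hτy, hτT, hτ1, hτ2⟩ : ∃ τ : ℝ≥0, 0 < τ ∧ s + τ ≤ y ∧ s + τ ≤ T ∧
          (τ : ℝ) ≤ δ₁ ∧ (τ : ℝ) ≤ δ₂ := by
        refine ⟨min (min (y - s) (T - s)) (min ⟨δ₁, hδ₁.le⟩ ⟨δ₂, hδ₂.le⟩), ?_, ?_, ?_, ?_, ?_⟩
        · refine lt_min (lt_min (tsub_pos_of_lt hy) (tsub_pos_of_lt hsT)) (lt_min ?_ ?_)
          · exact hδ₁
          · exact hδ₂
        · calc _ ≤ s + (y - s) := by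
                gcongr; exact (min_le_left _ _).trans (min_le_left _ _)
            _ = y := add_tsub_cancel_of_le hy.le
        · calc _ ≤ s + (T - s) := by
                gcongr; exact (min_le_left _ _).trans (min_le_right _ _)
            _ = T := add_tsub_cancel_of_le hsT.le
        · exact NNReal.coe_le_coe.2 ((min_le_right _ _).trans (min_le_left _ _))
        · exact NNReal.coe_le_coe.2 ((min_le_right _ _).trans (min_le_right _ _))
      refine ⟨s + τ, ?_, lt_add_of_pos_right s hτ0, hτy⟩
      intro η hη
      have hTs : (T - (s + τ)) + τ = T - s := by
        rw [← tsub_tsub]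
        exact tsub_add_cancel_of_le (le_tsub_of_add_le_left hτT)
      have h₃ := Metric.tendsto_nhds.1 (h.tendsto_floor_add g (T - (s + τ)) τ) (η / 3)
        (by positivity)
      rw [hTs] at h₃
      filter_upwards [hs (η / 3) (by positivity), h₂ τ hτ2 (η / (3 * M')) (by positivity), h₃]
        with r hr1 hr2 hr3
      rw [dist_zero_right] at hr3
      have hUg : U (s + τ) f = U τ g := by
        rw [add_comm, hU.map_add]; rfl
      rw [hUg]
      set p := ⌊(T - (s + τ)) / r⌋₊
      have hpT : (p : ℝ) * r ≤ T :=
        (floor_mul_le _ r).trans (NNReal.coe_le_coe.2 tsub_le_self)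
      -- Replace a time step `τ` of the discrete evolution by `U τ`. Both have the first-order term
      -- `τ • U s b`, which cancels because `(g, U s b)` lies in the closed graph of `Z`.
      have e1 : (F r ^ p) (U τ g) - (F r ^ ⌊T / r⌋₊) f =
          (F r ^ p) ((U τ g - g - ((τ : ℝ) : 𝕜) • U s b) -
            ((F r ^ ⌊τ / r⌋₊) g - g - ((τ : ℝ) : 𝕜) • U s b)) +
          ((F r ^ p) ((F r ^ ⌊τ / r⌋₊) g) - (F r ^ ⌊(T - s) / r⌋₊) g) +
          ((F r ^ ⌊(T - s) / r⌋₊) g - (F r ^ ⌊T / r⌋₊) f) := by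
        simp only [map_sub]; abel
      have e2 : ‖(F r ^ p) ((U τ g - g - ((τ : ℝ) : 𝕜) • U s b) -
            ((F r ^ ⌊τ / r⌋₊) g - g - ((τ : ℝ) : 𝕜) • U s b))‖ ≤ ε * τ + η / 3 := by
        refine (h.norm_pow_apply_le hpT _).trans ?_
        calc _ ≤ M' * (ε / (2 * M') * τ + (ε / (2 * M') * τ + η / (3 * M'))) := by
              gcongr
              exact (norm_sub_le _ _).trans (add_le_add (h₁ τ hτ1) hr2)
          _ = ε * τ + η / 3 := by field_simp; ring
      rw [e1]
      refine norm_add₃_le.trans ?_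
      rw [NNReal.coe_add, mul_add]
      linarith
  refine Metric.tendsto_nhds.2 fun ε hε => ?_
  have hT1 : 0 < (T : ℝ) + 1 := by positivity
  filter_upwards [key (ε / 2 / (T + 1)) (by positivity) (ε / 2 / (T + 1)) (by positivity)]
    with r hr
  rw [tsub_self, zero_div, Nat.floor_zero, pow_zero, norm_sub_rev] at hr
  rw [dist_eq_norm]
  refine lt_of_le_of_lt hr ?_
  have : ε / 2 / (T + 1) * T + ε / 2 / (T + 1) = ε / 2 := by field_simp
  linarith

theorem tendsto_semigroup (h : StableConsistent F Z M a) {U : ℝ≥0 → X →L[𝕜] X}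
    (hU : IsC0Semigroup U) (hZU : Z ≤ strongDerivAtZero U)
    (hUZ : (strongDerivAtZero U).graph ≤ Z.graph.topologicalClosure) (T : ℝ≥0) (f : X) :
    Tendsto (fun r : ℝ≥0 => (F r ^ ⌊T / r⌋₊) f) (𝓝[>] 0) (𝓝 (U T f)) :=
  h.tendsto_of_dense h.dense (fun _ hx => h.tendsto_of_mem_domain hU hUZ T (hZU.1 hx)) f

end StableConsistent

theorem tendsto_div_natCast_nhdsGT {t : ℝ≥0} (ht : 0 < t) :
    Tendsto (fun n : ℕ => t / (n : ℝ≥0)) atTop (𝓝[>] 0) := by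
  refine tendsto_nhdsWithin_iff.2 ⟨?_, ?_⟩
  · rw [← NNReal.tendsto_coe]
    simpa using tendsto_const_div_atTop_nhds_zero_nat (t : ℝ)
  · filter_upwards [eventually_ge_atTop 1] with n hn
    exact div_pos ht (by exact_mod_cast hn)

theorem mul_div_div_natCast {t s : ℝ≥0} (ht : 0 < t) {n : ℕ} (hn : 1 ≤ n) :
    t * s / (t / (n : ℝ≥0)) = n * s := by
  have : (n : ℝ≥0) ≠ 0 := by positivity
  field_simp

end Chernoff

/-! ### Resolvent estimates and a core criterion -/

section Generation

variable {𝕜 X : Type*} [RCLike 𝕜] [NormedAddCommGroup X] [NormedSpace 𝕜 X]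

theorem Submodule.dense_of_forall_dual_eq_zero (W : Submodule 𝕜 X)
    (hW : ∀ φ : StrongDual 𝕜 X, (∀ w ∈ W, φ w = 0) → φ = 0) : Dense (W : Set X) := by
  rw [Submodule.dense_iff_topologicalClosure_eq_top, eq_top_iff]
  intro x _
  by_contra hx
  have : IsClosed (W.topologicalClosure : Set X) := W.isClosed_topologicalClosure
  have hx0 : W.topologicalClosure.mkQL x ≠ 0 := by
    rw [Submodule.mkQL_apply, Submodule.mkQ_apply]
    exact fun h => hx ((Submodule.Quotient.mk_eq_zero _).1 h)
  obtain ⟨g, hg⟩ := SeparatingDual.exists_ne_zero (R := 𝕜) hx0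
  refine hg ?_
  have := hW (g.comp W.topologicalClosure.mkQL) fun w hw => by
    rw [ContinuousLinearMap.comp_apply, Submodule.mkQL_apply, Submodule.mkQ_apply,
      (Submodule.Quotient.mk_eq_zero _).2 (W.le_topologicalClosure hw), map_zero]
  exact DFunLike.congr_fun this x

namespace IsC0Semigroup

variable {U : ℝ≥0 → X →L[𝕜] X}

theorem hasDerivWithinAt_dual (hU : IsC0Semigroup U) {x y : X} (h : HasStrongDerivAtZero U x y)
    (φ : StrongDual 𝕜 X) {s : ℝ} (hs : 0 ≤ s) :
    HasDerivWithinAt (fun s : ℝ => φ (U s.toNNReal x)) (φ (U s.toNNReal y)) (Set.Ici s) s := by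
  rw [hasDerivWithinAt_iff_isLittleO, Asymptotics.isLittleO_iff]
  intro ε hε
  obtain ⟨δ, hδ, hd⟩ := (hU.hasStrongDerivAtZero_apply h s.toNNReal).exists_norm_sub_le
    hU.map_zero (ε := ε / (‖φ‖ + 1)) (by positivity)
  have hev : ∀ᶠ s' in 𝓝[Set.Ici s] s, s' < s + δ :=
    nhdsWithin_le_nhds (gt_mem_nhds (lt_add_of_pos_right s hδ))
  filter_upwards [hev, self_mem_nhdsWithin] with s' hs' hss'
  have hss' : 0 ≤ s' - s := sub_nonneg.2 hss'
  have h1 : s'.toNNReal = (s' - s).toNNReal + s.toNNReal := by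
    rw [← Real.toNNReal_add hss' hs, sub_add_cancel]
  have h2 := hd (s' - s).toNNReal (by rw [Real.coe_toNNReal _ hss']; linarith)
  rw [Real.coe_toNNReal _ hss'] at h2
  have h3 : φ (U s'.toNNReal x) - φ (U s.toNNReal x) - (s' - s) • φ (U s.toNNReal y) =
      φ (U (s' - s).toNNReal (U s.toNNReal x) - U s.toNNReal x -
        ((s' - s : ℝ) : 𝕜) • U s.toNNReal y) := by
    rw [h1, hU.map_add, map_sub, map_sub, map_smul, RCLike.real_smul_eq_coe_mul, smul_eq_mul]
    rfl
  rw [h3, Real.norm_of_nonneg hss']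
  refine (φ.le_opNorm _).trans ?_
  calc _ ≤ (‖φ‖ + 1) * (ε / (‖φ‖ + 1) * (s' - s)) := by
        gcongr
        linarith
    _ = ε * (s' - s) := by field_simp

/-- The mean value inequality for `s ↦ exp(-c s) φ(U s x)`, whose right derivative is `-exp(-c s)
φ(U s (c x - y))`. It replaces the Laplace transform representation of the resolvent. -/
theorem norm_exp_mul_dual_sub_le (hU : IsC0Semigroup U) {x y : X}
    (h : HasStrongDerivAtZero U x y) (φ : StrongDual 𝕜 X) (c : ℝ) {K : ℝ} (S : ℝ≥0)
    (hK : ∀ s : ℝ≥0, ‖φ (U s ((c : 𝕜) • x - y))‖ ≤ K * Real.exp (c * s)) :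
    ‖Real.exp (-(c * S)) • φ (U S x) - φ x‖ ≤ K * S := by
  have hd : ∀ s : ℝ, 0 ≤ s → HasDerivWithinAt
      (fun s : ℝ => Real.exp (-(c * s)) • φ (U s.toNNReal x))
      (-(Real.exp (-(c * s)) • φ (U s.toNNReal ((c : 𝕜) • x - y)))) (Set.Ici s) s := fun s hs => by
    have h1 : HasDerivAt (fun s : ℝ => Real.exp (-(c * s))) (Real.exp (-(c * s)) * -(c * 1)) s :=
      (((hasDerivAt_id s).const_mul c).neg).exp
    refine (h1.hasDerivWithinAt.smul (hU.hasDerivWithinAt_dual h φ hs)).congr_deriv ?_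
    simp only [map_sub, map_smul, RCLike.real_smul_eq_coe_mul, smul_eq_mul]
    push_cast
    ring
  have hc : ContinuousOn (fun s : ℝ => Real.exp (-(c * s)) • φ (U s.toNNReal x))
      (Set.Icc 0 (S : ℝ)) := by
    have h1 : Continuous fun s : ℝ => φ (U s.toNNReal x) :=
      φ.continuous.comp ((hU.continuous_apply x).comp continuous_real_toNNReal)
    have h2 : Continuous fun s : ℝ => Real.exp (-(c * s)) := by fun_prop
    exact (h2.smul h1).continuousOn
  have := norm_image_sub_le_of_norm_deriv_right_le_segment hc (fun s hs => hd s hs.1) (C := K)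
    (fun s hs => by
      rw [norm_neg, norm_smul, Real.norm_eq_abs, Real.abs_exp, Real.exp_neg,
        inv_mul_le_iff₀ (Real.exp_pos _), mul_comm]
      simpa [Real.coe_toNNReal _ hs.1] using hK s.toNNReal)
    S (Set.right_mem_Icc.2 S.2)
  simpa [hU.map_zero] using this

/-- The resolvent estimate at one point. -/
theorem exists_norm_le_norm_smul_sub (hU : IsC0Semigroup U) {M a : ℝ} (hM : 1 ≤ M)
    (hb : ∀ s, ‖U s‖ ≤ M * Real.exp (a * s)) :
    ∃ c > (0 : ℝ), ∀ x y : X, HasStrongDerivAtZero U x y →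
      ‖x‖ ≤ c * ‖((a + 1 : ℝ) : 𝕜) • x - y‖ := by
  have hM0 : 0 < M := zero_lt_one.trans_le hM
  have hlog : 0 < Real.log (2 * M) := Real.log_pos (by linarith)
  -- At time `S = log (2M)` the factor `exp(-(a+1)S) * M * exp(aS)` equals `1/2`, so the term at `S`
  -- is at most half of `‖x‖` and can be absorbed.
  refine ⟨2 * (M * Real.log (2 * M)), by positivity, fun x y h => ?_⟩
  set z := ((a + 1 : ℝ) : 𝕜) • x - y
  obtain ⟨φ, hφ, hφx⟩ := exists_dual_vector'' 𝕜 x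
  have hle : ∀ s w, ‖φ (U s w)‖ ≤ M * Real.exp (a * s) * ‖w‖ := fun s w => by
    refine (φ.le_opNorm _).trans ?_
    calc _ ≤ 1 * ‖U s w‖ := by gcongr
      _ ≤ _ := by rw [one_mul]; exact (U s).le_of_opNorm_le (hb s) w
  have h1 := hU.norm_exp_mul_dual_sub_le h φ (a + 1) (K := M * ‖z‖) ⟨Real.log (2 * M), hlog.le⟩
    fun s => (hle s z).trans (by
      have : Real.exp (a * s) ≤ Real.exp ((a + 1) * s) := by
        gcongr; linarith
      calc _ = M * ‖z‖ * Real.exp (a * s) := by ring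
        _ ≤ _ := by gcongr)
  set S : ℝ≥0 := ⟨Real.log (2 * M), hlog.le⟩ with hS
  have hS' : (S : ℝ) = Real.log (2 * M) := rfl
  have h2 : ‖Real.exp (-((a + 1) * S)) • φ (U S x)‖ ≤ ‖x‖ / 2 := by
    rw [norm_smul, Real.norm_eq_abs, Real.abs_exp]
    calc _ ≤ Real.exp (-((a + 1) * S)) * (M * Real.exp (a * S) * ‖x‖) := by
          gcongr; exact hle S x
      _ = (Real.exp (-((a + 1) * S)) * Real.exp (a * S)) * (M * ‖x‖) := by ring
      _ = (2 * M)⁻¹ * (M * ‖x‖) := by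
          rw [← Real.exp_add, show -((a + 1) * (S : ℝ)) + a * S = -S by ring, hS', Real.exp_neg,
            Real.exp_log (by positivity)]
      _ = ‖x‖ / 2 := by field_simp
  have h3 : ‖φ x‖ = ‖x‖ := by rw [hφx]; simp
  have h4 := norm_sub_norm_le (φ x) (Real.exp (-((a + 1) * S)) • φ (U S x))
  rw [norm_sub_rev, h3] at h4
  rw [hS'] at h1 h4 h2
  linarith

/-- With `λ = a + 1`, the range of `λ - G` is dense: if `φ` annihilates it, then for `f ∈ A` the
function `exp(-λ s) φ(U s f)` has zero derivative, since each `U s f` lies in the domain of `G`;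
being constant and decaying, it vanishes. The resolvent estimate turns approximation of `λ x - y`
into approximation of `(x, y)`, and `G` is closed. -/
theorem graph_le_of_dense (hU : IsC0Semigroup U) {G : Submodule 𝕜 (X × X)}
    (hG : IsClosed (G : Set (X × X))) (hGU : G ≤ (strongDerivAtZero U).graph) {A : Set X}
    (hA : Dense A) (hAG : ∀ f ∈ A, ∀ s, ∃ y, (U s f, y) ∈ G) :
    (strongDerivAtZero U).graph ≤ G := by
  obtain ⟨M, a, hM, hb⟩ := hU.exp_bound
  obtain ⟨c, hc, hcx⟩ := hU.exists_norm_le_norm_smul_sub hM hb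
  have hM0 : 0 < M := zero_lt_one.trans_le hM
  set L : X × X →ₗ[𝕜] X :=
    ((a + 1 : ℝ) : 𝕜) • LinearMap.fst 𝕜 X X - LinearMap.snd 𝕜 X X with hL
  have hLa : ∀ x y, L (x, y) = ((a + 1 : ℝ) : 𝕜) • x - y := fun x y => rfl
  have hdense : Dense ((G.map L : Submodule 𝕜 X) : Set X) := by
    refine Submodule.dense_of_forall_dual_eq_zero _ fun φ hφ => ?_
    have hz : ∀ f ∈ A, φ f = 0 := by
      intro f hf
      obtain ⟨b, hfb⟩ := hAG f hf 0
      rw [hU.map_zero, ContinuousLinearMap.id_apply] at hfb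
      have hfb := mem_graph_strongDerivAtZero.1 (hGU hfb)
      have hK : ∀ s : ℝ≥0, ‖φ (U s (((a + 1 : ℝ) : 𝕜) • f - b))‖ ≤
          0 * Real.exp ((a + 1 : ℝ) * s) := fun s => by
        obtain ⟨y, hy⟩ := hAG f hf s
        have hyb := (mem_graph_strongDerivAtZero.1 (hGU hy)).unique
          (hU.hasStrongDerivAtZero_apply hfb s)
        rw [map_sub, map_smul, ← hyb, ← hLa, hφ _ (Submodule.mem_map_of_mem hy)]
        simp
      have hle : ∀ S : ℝ≥0, ‖φ f‖ ≤ Real.exp (-(S : ℝ)) * (‖φ‖ * (M * ‖f‖)) := fun S => by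
        have h1 := hU.norm_exp_mul_dual_sub_le hfb φ (a + 1) S hK
        rw [zero_mul, norm_le_zero_iff, sub_eq_zero] at h1
        rw [← h1, norm_smul, Real.norm_eq_abs, Real.abs_exp]
        calc _ ≤ Real.exp (-((a + 1) * S)) * (‖φ‖ * (M * Real.exp (a * S) * ‖f‖)) := by
              gcongr
              refine (φ.le_opNorm _).trans ?_
              gcongr
              exact (U S).le_of_opNorm_le (hb S) f
          _ = (Real.exp (-((a + 1) * S)) * Real.exp (a * S)) * (‖φ‖ * (M * ‖f‖)) := by ring
          _ = _ := by
              rw [← Real.exp_add, show -((a + 1) * (S : ℝ)) + a * S = -S by ring]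
      have hlim : Tendsto (fun S : ℝ≥0 => Real.exp (-(S : ℝ)) * (‖φ‖ * (M * ‖f‖))) atTop
          (𝓝 (0 * (‖φ‖ * (M * ‖f‖)))) :=
        (Real.tendsto_exp_neg_atTop_nhds_zero.comp
          (NNReal.tendsto_coe_atTop.2 tendsto_id)).mul_const _
      rw [zero_mul] at hlim
      exact norm_le_zero_iff.1 (ge_of_tendsto' hlim hle)
    ext x
    exact congr_fun (φ.continuous.ext_on hA continuous_const hz) x
  rintro ⟨x, y⟩ hxy
  refine hG.closure_subset (Metric.mem_closure_iff.2 fun ε hε => ?_)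
  set C := (|a + 1| + 1) * c + 1 with hC
  have hC0 : 0 < C := by positivity
  obtain ⟨w, ⟨⟨g, y'⟩, hg, rfl⟩, hw⟩ := hdense.exists_dist_lt (L (x, y)) (ε := ε / C)
    (by positivity)
  refine ⟨(g, y'), hg, ?_⟩
  have hsub := mem_graph_strongDerivAtZero.1 (sub_mem hxy (hGU hg))
  rw [dist_eq_norm, ← map_sub] at hw
  set v := L ((x, y) - (g, y')) with hv
  have hv' : v = ((a + 1 : ℝ) : 𝕜) • (x - g) - (y - y') := rfl
  have h1 : ‖x - g‖ ≤ c * ‖v‖ := hcx _ _ hsub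
  have h2 : ‖y - y'‖ ≤ |a + 1| * (c * ‖v‖) + ‖v‖ := by
    have : y - y' = ((a + 1 : ℝ) : 𝕜) • (x - g) - v := by rw [hv']; abel
    rw [this]
    refine (norm_sub_le _ _).trans ?_
    rw [norm_smul, RCLike.norm_ofReal]
    gcongr
  have h3 : ‖v‖ * C < ε := (lt_div_iff₀ hC0).1 hw
  have h4 : 0 ≤ |a + 1| * (c * ‖v‖) := by positivity
  have h5 : 0 ≤ c * ‖v‖ := by positivity
  have h6 := norm_nonneg v
  rw [Prod.dist_eq, max_lt_iff, dist_eq_norm, dist_eq_norm]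
  constructor <;> nlinarith

end IsC0Semigroup

/-! ### Limit semigroups, precompactness and the sum of generators -/

namespace StableConsistent

variable {F : ℝ≥0 → X →L[𝕜] X} {Z : X →ₗ.[𝕜] X} {M a : ℝ}

theorem exists_tendsto_of_dense [CompleteSpace X] (h : StableConsistent F Z M a)
    {l : Filter ℝ≥0} [l.NeBot] {A : Set X} (hA : Dense A) {τ : ℝ≥0}
    (hl : ∀ f ∈ A, ∃ u, Tendsto (fun r : ℝ≥0 => (F r ^ ⌊τ / r⌋₊) f) l (𝓝 u)) (x : X) :
    ∃ u, Tendsto (fun r : ℝ≥0 => (F r ^ ⌊τ / r⌋₊) x) l (𝓝 u) := by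
  refine cauchy_map_iff_exists_tendsto.1 (Metric.cauchy_iff.2 ⟨inferInstance, fun ε hε => ?_⟩)
  have hM' := h.pos τ
  set M' := M * Real.exp (a * τ) with hM'def
  obtain ⟨d, hd, hxd⟩ := hA.exists_dist_lt x (ε := ε / 4 / M') (by positivity)
  obtain ⟨u, hu⟩ := hl d hd
  refine ⟨Metric.ball u (ε / 2), ?_, fun y hy z hz => ?_⟩
  · rw [mem_map]
    filter_upwards [Metric.tendsto_nhds.1 hu (ε / 4) (by positivity)] with r hr
    have h2 := h.norm_pow_apply_le (floor_mul_le τ r) (x - d)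
    rw [map_sub, ← dist_eq_norm] at h2
    rw [dist_eq_norm, lt_div_iff₀ hM', mul_comm] at hxd
    have := dist_triangle ((F r ^ ⌊τ / r⌋₊) x) ((F r ^ ⌊τ / r⌋₊) d) u
    rw [Set.mem_preimage, Metric.mem_ball]
    linarith
  · have := dist_triangle_right y z u
    rw [Metric.mem_ball] at hy hz
    linarith

/-- All bounds are uniform in `r`, so they survive a limit along any filter finer than `𝓝[>] 0`;
this allows an ultrafilter. -/
theorem exists_semigroup_of_tendsto (h : StableConsistent F Z M a)
    {l : Filter ℝ≥0} [l.NeBot] (hl : l ≤ 𝓝[>] 0)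
    (hx : ∀ τ x, ∃ u, Tendsto (fun r : ℝ≥0 => (F r ^ ⌊τ / r⌋₊) x) l (𝓝 u)) :
    ∃ U : ℝ≥0 → X →L[𝕜] X, IsC0Semigroup U ∧
      ∀ τ x, Tendsto (fun r : ℝ≥0 => (F r ^ ⌊τ / r⌋₊) x) l (𝓝 (U τ x)) := by
  choose V hV using hx
  have hbound : ∀ τ x, ‖V τ x‖ ≤ M * Real.exp (a * τ) * ‖x‖ := fun τ x =>
    le_of_tendsto' (hV τ x).norm fun r => h.norm_pow_apply_le (floor_mul_le τ r) x
  let U : ℝ≥0 → X →L[𝕜] X := fun τ => LinearMap.mkContinuous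
    { toFun := V τ
      map_add' := fun x y => tendsto_nhds_unique (hV τ (x + y))
        (((hV τ x).add (hV τ y)).congr fun r => (map_add _ _ _).symm)
      map_smul' := fun c x => tendsto_nhds_unique (hV τ (c • x))
        (((hV τ x).const_smul c).congr fun r => (map_smul _ _ _).symm) }
    (M * Real.exp (a * τ)) (hbound τ)
  have hUV : ∀ τ x, U τ x = V τ x := fun τ x => rfl
  have hU : ∀ τ x, Tendsto (fun r : ℝ≥0 => (F r ^ ⌊τ / r⌋₊) x) l (𝓝 (U τ x)) := hV
  refine ⟨U, ⟨?_, fun σ τ => ?_, fun x => ?_, M, a, h.one_le, fun s => ?_⟩, hU⟩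
  · ext x
    exact tendsto_nhds_unique (hU 0 x) (by simp)
  · ext x
    refine tendsto_nhds_unique (hU (σ + τ) x) ?_
    have h1 := (h.tendsto_floor_add x σ τ).mono_left hl
    have h2 : Tendsto (fun r : ℝ≥0 => (F r ^ ⌊σ / r⌋₊) ((F r ^ ⌊τ / r⌋₊) x - U τ x)) l (𝓝 0) := by
      have h3 : Tendsto (fun r : ℝ≥0 => M * Real.exp (a * σ) * ‖(F r ^ ⌊τ / r⌋₊) x - U τ x‖) l
          (𝓝 0) := by
        simpa using ((hU τ x).sub_const (U τ x)).norm.const_mul (M * Real.exp (a * σ))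
      exact squeeze_zero_norm (fun r => h.norm_pow_apply_le (floor_mul_le σ r) _) h3
    have h4 := ((hU σ (U τ x)).add h2).sub h1
    rw [add_zero, sub_zero] at h4
    refine h4.congr fun r => ?_
    rw [map_sub]; abel
  · refine Metric.continuous_iff.2 fun τ ε hε => ?_
    obtain ⟨δ, hδ, hd⟩ := h.exists_norm_floor_sub_floor_le x (τ + 1) (half_pos hε)
    refine ⟨min δ 1, by positivity, fun σ hσ => ?_⟩
    have hσ1 := hσ.trans_le (min_le_right _ _)
    rw [NNReal.dist_eq, abs_lt] at hσ1
    have hev := hd σ τ (by linarith [hσ1.2]) (by linarith) (hσ.le.trans (min_le_left _ _))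
    rw [dist_eq_norm]
    exact (le_of_tendsto ((hU σ x).sub (hU τ x)).norm (hl hev)).trans_lt (half_lt_self hε)
  · exact LinearMap.mkContinuous_norm_le _ (h.pos s).le _

theorem graph_closure_le_of_tendsto (h : StableConsistent F Z M a)
    {l : Filter ℝ≥0} [l.NeBot] (hl : l ≤ 𝓝[>] 0) {U : ℝ≥0 → X →L[𝕜] X} (hU : IsC0Semigroup U)
    (hFU : ∀ τ x, Tendsto (fun r : ℝ≥0 => (F r ^ ⌊τ / r⌋₊) x) l (𝓝 (U τ x))) :
    Z.graph.topologicalClosure ≤ (strongDerivAtZero U).graph := by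
  rintro ⟨g, y⟩ hgy
  refine mem_graph_strongDerivAtZero.2
    (hasStrongDerivAtZero_of_exists_norm_sub_le hU.map_zero fun ε hε => ?_)
  obtain ⟨δ, hδ, hd⟩ := h.exists_norm_floor_sub_le hgy hε
  refine ⟨δ, hδ, fun τ hτ => le_of_forall_pos_le_add fun η hη => ?_⟩
  exact le_of_tendsto (((hFU τ g).sub_const g).sub_const _).norm (hl (hd τ hτ η hη))

theorem isClosable_and_isC0Generator [CompleteSpace X] (h : StableConsistent F Z M a) {t : ℝ≥0}
    (ht : 0 < t) (hZ : HasPrecompactApproximation F Z t) :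
    Z.IsClosable ∧ IsC0Generator Z.closure := by
  obtain ⟨A, -, hA, happ⟩ := hZ
  -- One ultrafilter makes every precompact sequence converge, for all `f` and `τ` at once; no
  -- diagonal subsequence is needed.
  let 𝒰 : Ultrafilter ℕ := Ultrafilter.of atTop
  have h𝒰 : (𝒰 : Filter ℕ) ≤ atTop := Ultrafilter.of_le atTop
  let l : Filter ℝ≥0 := map (fun n : ℕ => t / (n : ℝ≥0)) 𝒰
  have hl : l ≤ 𝓝[>] 0 := (tendsto_div_natCast_nhdsGT ht).mono_left h𝒰
  have hlim : ∀ f ∈ A, ∀ τ : ℝ≥0, ∃ p q : X, (p, q) ∈ Z.graph.topologicalClosure ∧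
      Tendsto (fun r : ℝ≥0 => (F r ^ ⌊τ / r⌋₊) f) l (𝓝 p) := by
    intro f hf τ
    -- `(F (t/n))^[ns]` runs for time about `t * s`, so time `τ` corresponds to `s = τ / t`.
    obtain ⟨u, hu, hu1, hu2⟩ := happ f hf (τ / t)
    have hge : ∀ᶠ n in (𝒰 : Filter ℕ), 1 ≤ n := h𝒰 (eventually_ge_atTop 1)
    have hconv : ∀ v : ℕ → X, IsPrecompactSet (v '' Set.Ici 1) →
        ∃ p, Tendsto v 𝒰 (𝓝 p) := fun v hv => by
      obtain ⟨p, -, hp⟩ := hv.ultrafilter_le_nhds (𝒰.map v) (by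
        rw [le_principal_iff, Ultrafilter.coe_map, mem_map]
        filter_upwards [hge] with n hn
        exact subset_closure ⟨n, hn, rfl⟩)
      exact ⟨p, hp⟩
    obtain ⟨p, hp⟩ := hconv _ hu1
    obtain ⟨q, hq⟩ := hconv _ hu2
    refine ⟨p, q, ?_, ?_⟩
    · exact mem_closure_of_tendsto (hp.prodMk_nhds hq)
        (Eventually.of_forall fun n => Z.mem_graph (u n))
    · refine tendsto_map'_iff.2 ?_
      have h1 := (tendsto_zero_iff_norm_tendsto_zero.2 (hu.mono_left h𝒰)).add hp
      rw [zero_add] at h1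
      refine h1.congr' ?_
      filter_upwards [hge] with n hn
      rw [sub_add_cancel, ← mul_div_div_natCast ht hn, mul_div_cancel₀ _ ht.ne']
      rfl
  obtain ⟨U, hU, hFU⟩ := h.exists_semigroup_of_tendsto hl fun τ =>
    h.exists_tendsto_of_dense hA fun f hf =>
      let ⟨p, _, _, hp⟩ := hlim f hf τ
      ⟨p, hp⟩
  have hle := h.graph_closure_le_of_tendsto hl hU hFU
  have hge := hU.graph_le_of_dense Z.graph.isClosed_topologicalClosure hle hA fun f hf s => by
    obtain ⟨p, q, hpq, hp⟩ := hlim f hf s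
    rw [← tendsto_nhds_unique hp (hFU s f)]
    exact ⟨q, hpq⟩
  have heq := le_antisymm hle hge
  have hcl : Z.IsClosable := ⟨strongDerivAtZero U, heq⟩
  refine ⟨hcl, U, hU, LinearPMap.eq_of_eq_graph ?_⟩
  rw [← hcl.graph_closure_eq_closure_graph, heq]

theorem tendsto_of_isGeneratorOf (h : StableConsistent F Z M a) (hZ : Z.IsClosable)
    {U : ℝ≥0 → X →L[𝕜] X} (hU : IsGeneratorOf Z.closure U) (T : ℝ≥0) (f : X) :
    Tendsto (fun r : ℝ≥0 => (F r ^ ⌊T / r⌋₊) f) (𝓝[>] 0) (𝓝 (U T f)) := by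
  refine h.tendsto_semigroup hU.1 ?_ ?_ T f
  · rw [← hU.2]; exact Z.le_closure
  · rw [← hU.2, hZ.graph_closure_eq_closure_graph]

theorem isPrecompactSet_image_of_tendsto {v : ℕ → X} {p : X} (hv : Tendsto v atTop (𝓝 p))
    (s : Set ℕ) : IsPrecompactSet (v '' s) :=
  hv.isCompact_insert_range.closure_of_subset
    ((Set.image_subset_range v s).trans (Set.subset_insert _ _))

theorem hasPrecompactApproximation (h : StableConsistent F Z M a) {t : ℝ≥0} (ht : 0 < t)
    (hZ : Z.IsClosable) (hgen : IsC0Generator Z.closure) : HasPrecompactApproximation F Z t := by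
  obtain ⟨U, hU⟩ := hgen
  refine ⟨Z.domain, le_rfl, h.dense, fun f hf s => ?_⟩
  have hF : Tendsto (fun n : ℕ => (F (t / n) ^ ⌊(n : ℝ≥0) * s⌋₊) f) atTop (𝓝 (U (t * s) f)) := by
    refine ((h.tendsto_of_isGeneratorOf hZ hU (t * s) f).comp
      (tendsto_div_natCast_nhdsGT ht)).congr' ?_
    filter_upwards [eventually_ge_atTop 1] with n hn
    rw [Function.comp_apply, mul_div_div_natCast ht hn]
  have hmem : (U (t * s) f, U (t * s) (Z ⟨f, hf⟩)) ∈ Z.graph.topologicalClosure := by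
    rw [hZ.graph_closure_eq_closure_graph, hU.2]
    refine mem_graph_strongDerivAtZero.2 (hU.1.hasStrongDerivAtZero_apply ?_ _)
    rw [← mem_graph_strongDerivAtZero, ← hU.2]
    exact LinearPMap.le_graph_of_le Z.le_closure (Z.mem_graph ⟨f, hf⟩)
  obtain ⟨v, hv, hlim⟩ := mem_closure_iff_seq_limit.1 hmem
  choose u hu1 hu2 using fun n => (LinearPMap.mem_graph_iff Z).1 (hv n)
  have hl1 : Tendsto (fun n => (u n : X)) atTop (𝓝 (U (t * s) f)) := by
    simp only [hu1]
    exact (continuous_fst.tendsto _).comp hlim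
  have hl2 : Tendsto (fun n => Z (u n)) atTop (𝓝 (U (t * s) (Z ⟨f, hf⟩))) := by
    simp only [hu2]
    exact (continuous_snd.tendsto _).comp hlim
  refine ⟨u, ?_, isPrecompactSet_image_of_tendsto hl1 _, isPrecompactSet_image_of_tendsto hl2 _⟩
  have := (hF.sub hl1).norm
  rwa [sub_self, norm_zero] at this

/-- Product rule: `expC r (expD r x) - x = (expC r x - x) + expC r (expD r x - x)`; local
boundedness and strong continuity of `expC` handle the last term after division by `r`. -/
theorem of_comp {C D : X →ₗ.[𝕜] X} {expC expD : ℝ≥0 → X →L[𝕜] X}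
    (hC : IsGeneratorOf C expC) (hD : IsGeneratorOf D expD)
    (hdense : Dense ((C.domain ⊓ D.domain : Submodule 𝕜 X) : Set X)) (hM : 1 ≤ M) (ha : 0 ≤ a)
    (hstable : ∀ (r : ℝ≥0) (m : ℕ),
      ‖((expC r).comp (expD r)) ^ m‖ ≤ M * Real.exp (a * (m * r))) :
    StableConsistent (fun s => (expC s).comp (expD s)) (C + D) M a := by
  refine ⟨hM, ha, hstable, ?_, hdense, fun x => ?_⟩
  · simp only [hC.1.map_zero, hD.1.map_zero]
    rfl
  have hx : (x : X) ∈ C.domain ∧ (x : X) ∈ D.domain := x.2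
  have hCx : HasStrongDerivAtZero expC (x : X) (C ⟨x, hx.1⟩) := by
    rw [← mem_graph_strongDerivAtZero, ← hC.2]
    exact C.mem_graph ⟨x, hx.1⟩
  have hDx : HasStrongDerivAtZero expD (x : X) (D ⟨x, hx.2⟩) := by
    rw [← mem_graph_strongDerivAtZero, ← hD.2]
    exact D.mem_graph ⟨x, hx.2⟩
  set y := D ⟨x, hx.2⟩
  have hval : (C + D) x = C ⟨x, hx.1⟩ + y := rfl
  rw [hval]
  obtain ⟨K, b, hK, hKb⟩ := hC.1.exp_bound
  have hcont : Tendsto (fun r : ℝ≥0 => expC r y) (𝓝[>] 0) (𝓝 y) := by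
    have := ((hC.1.continuous_apply y).tendsto 0).mono_left
      (nhdsWithin_le_nhds (s := Set.Ioi (0 : ℝ≥0)))
    rwa [hC.1.map_zero] at this
  have hsmall : Tendsto (fun r : ℝ≥0 => expC r ((((r : ℝ) : 𝕜))⁻¹ • (expD r x - expD 0 x) - y))
      (𝓝[>] 0) (𝓝 0) := by
    have h1 : Tendsto (fun r : ℝ≥0 => K * Real.exp (b * r) *
        ‖(((r : ℝ) : 𝕜))⁻¹ • (expD r x - expD 0 x) - y‖) (𝓝[>] 0)
        (𝓝 (K * Real.exp (b * (0 : ℝ≥0)) * 0)) := by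
      refine Tendsto.mul ?_ ?_
      · have : Continuous fun r : ℝ≥0 => K * Real.exp (b * r) := by fun_prop
        exact (this.tendsto 0).mono_left nhdsWithin_le_nhds
      · exact tendsto_iff_norm_sub_tendsto_zero.1 hDx
    rw [mul_zero] at h1
    exact squeeze_zero_norm (fun r => (expC r).le_of_opNorm_le (hKb r) _) h1
  have hsum := Tendsto.add hCx (hcont.add hsmall)
  rw [add_zero] at hsum
  refine hsum.congr fun r => ?_
  simp only [map_sub, map_smul, ContinuousLinearMap.comp_apply, hC.1.map_zero, hD.1.map_zero,
    ContinuousLinearMap.id_apply, smul_sub]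
  abel

end StableConsistent

end Generation

end

theorem mainTheorem9 {𝕜 X : Type*} [RCLike 𝕜] [NormedAddCommGroup X] [NormedSpace 𝕜 X]
    [CompleteSpace X]
    (t : ℝ≥0) (ht : 0 < t)
    (C D : X →ₗ.[𝕜] X) (expC expD : ℝ≥0 → X →L[𝕜] X)
    (hC : IsGeneratorOf C expC) (hD : IsGeneratorOf D expD)
    (hdense : Dense ((C.domain ⊓ D.domain : Submodule 𝕜 X) : Set X))
    (hstable : ∃ a M : ℝ, 1 ≤ M ∧ ∀ n m : ℕ, 1 ≤ n → ∀ s : ℝ≥0,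
      ‖((expC (s / n)).comp (expD (s / n))) ^ m‖ ≤ M * Real.exp (a * s * (m / n))) :
    (((C + D).IsClosable ∧ IsC0Generator (C + D).closure) ↔
      HasPrecompactApproximation (fun s => (expC s).comp (expD s)) (C + D) t) ∧
    (HasPrecompactApproximation (fun s => (expC s).comp (expD s)) (C + D) t →
      ∀ U : ℝ≥0 → X →L[𝕜] X, IsGeneratorOf (C + D).closure U →
        ∀ f : X, ∀ s : ℝ≥0, 0 < s →
          Tendsto (fun n : ℕ => (((expC (s / n)).comp (expD (s / n))) ^ n) f)
            atTop (𝓝 (U s f))) := by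
  obtain ⟨a, M, hM, hst⟩ := hstable
  -- The case `n = 1` of the stability hypothesis already covers every step size. Replacing `a` by
  -- `max a 0` makes the bounds monotone in time.
  have h : StableConsistent (fun s => (expC s).comp (expD s)) (C + D) M (max a 0) := by
    refine StableConsistent.of_comp hC hD hdense hM (le_max_right _ _) fun r m => ?_
    have h1 := hst 1 m le_rfl r
    simp only [Nat.cast_one, div_one] at h1
    refine h1.trans ?_
    rw [mul_assoc, mul_comm (r : ℝ)]
    gcongr
    exact le_max_left _ _
  refine ⟨⟨fun hg => h.hasPrecompactApproximation ht hg.1 hg.2,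
    h.isClosable_and_isC0Generator ht⟩, fun hp U hU f s hs => ?_⟩
  refine ((h.tendsto_of_isGeneratorOf (h.isClosable_and_isC0Generator ht hp).1 hU s f).comp
    (tendsto_div_natCast_nhdsGT hs)).congr' ?_
  filter_upwards [eventually_ge_atTop 1] with n hn
  have h2 := mul_div_div_natCast (s := 1) hs hn
  rw [mul_one, mul_one] at h2
  rw [Function.comp_apply, h2, Nat.floor_natCast]
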